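/- **Theorem B.** By a class of groups we mean a class closed under isomorphism. Let $\mathcal{C}$ be a class of groups that is closed under taking subgroups and finite direct products (the empty product, i.e. the trivial group, included), and suppose that every graph product of residually $\mathcal{C}$ groups is residually $\mathcal{C}$. Then every graph product of groups that are locally embeddable into $\mathcal{C}$ is again locally embeddable into $\mathcal{C}$. Here, for a graph $\Gamma=(V,E)$ without loops or multiple edges, with vertex set $V$ of arbitrary cardinality, and a family of groups $\{G_v\}_{v\in V}$, the *graph product* is the quotient of the free product $\ast_{v\in V}G_v$ by the relations $g_ug_v=g_vg_u$ for all $g_u\in G_u$, $g_v\in G_v$ and $\{u,v\}\in E$. A group $G$ is *residually $\mathcal{C}$* if for every $g\in G\setminus\{e\}$ there are $C\in\mathcal{C}$ and a surjective homomorphism $\varphi\colon G\to C$ with $\varphi(g)\neq e$. A group $G$ is *locally embeddable into $\mathcal{C}$* if for every finite $K\subseteq G$ there are $C\in\mathcal{C}$ and a map $\varphi\colon G\to C$ such that $\varphi|_K$ is injective and $\varphi(k_1k_2)=\varphi(k_1)\varphi(k_2)$ for all $k_1,k_2\in K$. -/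

import Mathlib

universe u v

/-- The relators of a graph product: the commutators `a b a⁻¹ b⁻¹` in the free product, where
`a ∈ G u`, `b ∈ G v` and `u`, `v` are adjacent. -/
def GraphProduct.relators {V : Type v} (Γ : SimpleGraph V) (G : V → Type u) [∀ v, Group (G v)] :
    Set (Monoid.CoprodI G) :=
  {x | ∃ (u v : V) (a : G u) (b : G v), Γ.Adj u v ∧
    x = Monoid.CoprodI.of a * Monoid.CoprodI.of b *
      (Monoid.CoprodI.of a)⁻¹ * (Monoid.CoprodI.of b)⁻¹}

/-- The graph product of the groups `G v` with respect to the simple graph `Γ`: the quotient of the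
free product of the `G v` by the relations `a b = b a` for `a ∈ G u`, `b ∈ G v` with `u`, `v`
adjacent. -/
def GraphProduct {V : Type v} (Γ : SimpleGraph V) (G : V → Type u) [∀ v, Group (G v)] :
    Type (max u v) :=
  Monoid.CoprodI G ⧸ Subgroup.normalClosure (GraphProduct.relators Γ G)

instance GraphProduct.instGroup {V : Type v} (Γ : SimpleGraph V) (G : V → Type u)
    [∀ v, Group (G v)] : Group (GraphProduct Γ G) :=
  inferInstanceAs (Group (Monoid.CoprodI G ⧸ Subgroup.normalClosure (GraphProduct.relators Γ G)))

/-- `f : G → C` is a `K`-almost-homomorphism: multiplicative on `K` and injective on `K`. -/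
def IsAlmostHom {G C : Type*} [Group G] [Group C] (K : Set G) (f : G → C) : Prop :=
  (∀ k₁ ∈ K, ∀ k₂ ∈ K, f (k₁ * k₂) = f k₁ * f k₂) ∧ Set.InjOn f K

/-- A class of groups, i.e. a property of groups that is invariant under isomorphism. -/
structure GroupClass where
  /-- `Mem G` says that the group `G` belongs to the class. -/
  Mem : ∀ (G : Type u) [Group G], Prop
  mem_of_equiv : ∀ {G H : Type u} [Group G] [Group H], G ≃* H → Mem G → Mem H

namespace GroupClass

/-- Every subgroup of a group in the class is in the class. -/
def ClosedUnderSubgroups (𝒞 : GroupClass.{u}) : Prop :=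
  ∀ (G : Type u) [Group G], 𝒞.Mem G → ∀ H : Subgroup G, 𝒞.Mem H

/-- Every direct product of finitely many (possibly zero) groups in the class is in the class. -/
def ClosedUnderFiniteProducts (𝒞 : GroupClass.{u}) : Prop :=
  ∀ (ι : Type) [Finite ι] (G : ι → Type u) [∀ i, Group (G i)],
    (∀ i, 𝒞.Mem (G i)) → 𝒞.Mem (∀ i, G i)

/-- Every graph product, over an arbitrary (possibly infinite) simple graph, of groups in the class
is in the class. -/
def ClosedUnderGraphProducts (𝒞 : GroupClass.{u}) : Prop :=
  ∀ (V : Type u) (Γ : SimpleGraph V) (G : V → Type u) [∀ v, Group (G v)],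
    (∀ v, 𝒞.Mem (G v)) → 𝒞.Mem (GraphProduct Γ G)

/-- The class of residually `𝒞` groups. -/
def residually (𝒞 : GroupClass.{u}) : GroupClass.{u} where
  Mem G _ := ∀ g : G, g ≠ 1 → ∃ (C : Type u) (_ : Group C) (φ : G →* C),
    𝒞.Mem C ∧ Function.Surjective φ ∧ φ g ≠ 1
  mem_of_equiv {G H} _ _ e h g hg := by
    obtain ⟨C, iC, φ, hC, hs, hne⟩ := h (e.symm g) (by simpa using hg)
    exact ⟨C, iC, φ.comp e.symm.toMonoidHom, hC, hs.comp e.symm.surjective, hne⟩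

/-- The class of groups that are locally embeddable into `𝒞` (LE-`𝒞` groups). -/
def locallyEmbeddable (𝒞 : GroupClass.{u}) : GroupClass.{u} where
  Mem G _ := ∀ K : Set G, K.Finite → ∃ (C : Type u) (_ : Group C) (f : G → C),
    𝒞.Mem C ∧ IsAlmostHom K f
  mem_of_equiv {G H} _ _ e h K hK := by
    obtain ⟨C, iC, f, hC, hm, hi⟩ := h (e.symm '' K) (hK.image _)
    refine ⟨C, iC, f ∘ e.symm, hC, fun k₁ h₁ k₂ h₂ => ?_, fun a ha b hb hab => ?_⟩
    · simpa using hm _ ⟨k₁, h₁, rfl⟩ _ ⟨k₂, h₂, rfl⟩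
    · exact e.symm.injective (hi ⟨a, ha, rfl⟩ ⟨b, hb, rfl⟩ hab)

end GroupClass

open Filter

namespace GraphProduct

section Basic

variable {V : Type v} {Γ : SimpleGraph V} {G : V → Type u} [∀ v, Group (G v)]

/-- The canonical homomorphism from a vertex group to the graph product. -/
def of (Γ : SimpleGraph V) {G : V → Type u} [∀ v, Group (G v)] (v : V) :
    G v →* GraphProduct Γ G :=
  (QuotientGroup.mk' (Subgroup.normalClosure (relators Γ G))).comp Monoid.CoprodI.of

theorem commute_of {u v : V} (h : Γ.Adj u v) (a : G u) (b : G v) :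
    Commute (of Γ u a) (of Γ v b) := by
  have hmem : Monoid.CoprodI.of a * Monoid.CoprodI.of b * (Monoid.CoprodI.of a)⁻¹ *
      (Monoid.CoprodI.of b)⁻¹ ∈ Subgroup.normalClosure (relators Γ G) :=
    Subgroup.subset_normalClosure ⟨u, v, a, b, h, rfl⟩
  have h1 : of Γ u a * of Γ v b * (of Γ u a)⁻¹ * (of Γ v b)⁻¹ = 1 :=
    (QuotientGroup.eq_one_iff _).2 hmem
  rw [mul_inv_eq_one, mul_inv_eq_iff_eq_mul] at h1
  exact h1

/-- The universal property of the graph product. -/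
def lift {H : Type*} [Group H] (f : ∀ v, G v →* H)
    (hf : ∀ u v, Γ.Adj u v → ∀ (a : G u) (b : G v), Commute (f u a) (f v b)) :
    GraphProduct Γ G →* H :=
  QuotientGroup.lift (Subgroup.normalClosure (relators Γ G)) (Monoid.CoprodI.lift f) <| by
    refine Subgroup.normalClosure_le_normal ?_
    rintro _ ⟨u, v, a, b, h, rfl⟩
    simp [MonoidHom.mem_ker, (hf u v h a b).eq]

@[simp]
theorem lift_of {H : Type*} [Group H] (f : ∀ v, G v →* H)
    (hf : ∀ u v, Γ.Adj u v → ∀ (a : G u) (b : G v), Commute (f u a) (f v b)) (v : V) (a : G v) :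
    lift f hf (of Γ v a) = f v a :=
  Monoid.CoprodI.lift_of f a

/-- The element of the graph product represented by a word in the vertex groups. -/
def wordProd (Γ : SimpleGraph V) {G : V → Type u} [∀ v, Group (G v)] (w : List (Σ v, G v)) :
    GraphProduct Γ G :=
  (w.map fun l => of Γ l.1 l.2).prod

@[simp] theorem wordProd_nil : wordProd Γ ([] : List (Σ v, G v)) = 1 := rfl

@[simp]
theorem wordProd_cons (l : Σ v, G v) (w : List (Σ v, G v)) :
    wordProd Γ (l :: w) = of Γ l.1 l.2 * wordProd Γ w := by
  simp [wordProd]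

@[simp]
theorem wordProd_append (w w' : List (Σ v, G v)) :
    wordProd Γ (w ++ w') = wordProd Γ w * wordProd Γ w' := by
  simp [wordProd]

theorem exists_wordProd_eq (g : GraphProduct Γ G) : ∃ w, wordProd Γ w = g := by
  obtain ⟨x, rfl⟩ := QuotientGroup.mk'_surjective (Subgroup.normalClosure (relators Γ G)) g
  induction x using Monoid.CoprodI.induction_on with
  | one => exact ⟨[], rfl⟩
  | of v a => exact ⟨[⟨v, a⟩], by simp [wordProd]; rfl⟩
  | mul x y hx hy =>
    obtain ⟨w, hw⟩ := hx
    obtain ⟨w', hw'⟩ := hy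
    exact ⟨w ++ w', by rw [wordProd_append, hw, hw', map_mul]; rfl⟩

theorem commute_wordProd {v : V} (a : G v) (w : List (Σ v, G v))
    (h : ∀ l ∈ w, Γ.Adj l.1 v) : Commute (wordProd Γ w) (of Γ v a) := by
  induction w with
  | nil => exact Commute.one_left _
  | cons l w ih =>
    rw [wordProd_cons]
    exact (commute_of (h l (by simp)) _ _).mul_left (ih fun l' hl' => h l' (by simp [hl']))

/-- `v` occurs in the list `s` of vertices and can be shuffled to its front. -/
def CanLead (Γ : SimpleGraph V) (v : V) (s : List V) : Prop :=
  ∃ x y, s = x ++ v :: y ∧ ∀ u ∈ x, Γ.Adj u v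

/-- In the list of vertices no two occurrences of the same vertex can be shuffled together. -/
def Separated (Γ : SimpleGraph V) : List V → Prop
  | [] => True
  | v :: s => ¬ CanLead Γ v s ∧ Separated Γ s

/-- A word is reduced if its letters are nontrivial and no two of them can be merged. -/
def IsReduced (Γ : SimpleGraph V) (w : List (Σ v, G v)) : Prop :=
  (∀ l ∈ w, l.2 ≠ 1) ∧ Separated Γ (w.map Sigma.fst)

theorem isReduced_of_minimal (w : List (Σ v, G v))
    (h : ∀ w', wordProd Γ w' = wordProd Γ w → w.length ≤ w'.length) : IsReduced Γ w := by
  induction w with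
  | nil => simp [IsReduced, Separated]
  | cons l w ih =>
    obtain ⟨h1, h2⟩ := ih fun w' hw' => by simpa using h (l :: w') (by simp [hw'])
    obtain ⟨v, a⟩ := l
    refine ⟨?_, ?_, h2⟩
    · rintro l (_ | ⟨_, hl⟩)
      · intro (ha : a = 1)
        have := h w (by simp [ha])
        simp at this
      · exact h1 l hl
    · rintro ⟨x, y, hxy, hx⟩
      obtain ⟨x', z', rfl, rfl, hz⟩ := List.map_eq_append_iff.1 hxy
      obtain ⟨⟨v', b⟩, y', rfl, hv, rfl⟩ := List.map_eq_cons_iff.1 hz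
      obtain rfl : v' = v := hv
      have hc := commute_wordProd b x' fun l hl => hx l.1 (List.mem_map_of_mem hl)
      have := h (⟨v', a * b⟩ :: (x' ++ y')) (by
        simp only [wordProd_cons, wordProd_append, map_mul]
        rw [← mul_assoc (wordProd Γ x'), hc.eq]
        simp only [mul_assoc])
      simp at this

theorem exists_isReduced (g : GraphProduct Γ G) : ∃ w, IsReduced Γ w ∧ wordProd Γ w = g := by
  have hne : {w : List (Σ v, G v) | wordProd Γ w = g}.Nonempty := exists_wordProd_eq g
  obtain ⟨w, hw, hmin⟩ := (measure (List.length (α := Σ v, G v))).wf.has_min _ hne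
  exact ⟨w, isReduced_of_minimal w fun w' hw' => not_lt.1 (hmin w' (hw'.trans hw)), hw⟩

end Basic

section Action

/-- If `cons : H → X → X` is jointly injective, then `H` acts on `X` so that a nontrivial `a` maps
each `x` that is not of the form `cons b y` to `cons a x`. -/
theorem exists_permHom {H X : Type*} [Group H] (cons : H → X → X)
    (hinj : ∀ a b x y, cons a x = cons b y → a = b ∧ x = y) :
    ∃ ρ : H →* Equiv.Perm X, ∀ a x, a ≠ 1 → (∀ b y, x ≠ cons b y) → ρ a x = cons a x := by
  classical
  let D := {x : X // ∀ b y, x ≠ cons b y}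
  let ι : H × D ↪ X :=
    { toFun := fun p => if p.1 = 1 then p.2.1 else cons p.1 p.2.1
      inj' := by
        rintro ⟨a, x, hx⟩ ⟨b, y, hy⟩ h
        by_cases ha : a = 1 <;> by_cases hb : b = 1 <;> simp only [ha, hb, if_true, if_false] at h
        · subst ha hb h; rfl
        · exact absurd h (hx _ _)
        · exact absurd h.symm (hy _ _)
        · obtain ⟨rfl, rfl⟩ := hinj _ _ _ _ h; rfl }
  let τ : H →* Equiv.Perm (H × D) :=
    { toFun := fun a => (Equiv.mulLeft a).prodCongr (Equiv.refl D)
      map_one' := by ext p <;> simp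
      map_mul' := fun a b => by ext p <;> simp [mul_assoc] }
  refine ⟨(Equiv.Perm.viaEmbeddingHom ι).comp τ, fun a x ha hx => ?_⟩
  have h1 : ι (1, ⟨x, hx⟩) = x := if_pos rfl
  have h2 : ι (a, ⟨x, hx⟩) = cons a x := if_neg ha
  have h3 := Equiv.Perm.viaEmbedding_apply (τ a) ι (1, ⟨x, hx⟩)
  rw [h1] at h3
  refine h3.trans (Eq.trans ?_ h2)
  simp [τ]

open Classical in
/-- Apply a permutation of the families over `s` to the coordinates in `s`. -/
noncomputable def permOn {ι L : Type*} (s : Set ι) :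
    Equiv.Perm (s → L) →* Equiv.Perm (ι → L) where
  toFun σ :=
    { toFun := fun F i => if h : i ∈ s then σ (fun j => F j) ⟨i, h⟩ else F i
      invFun := fun F i => if h : i ∈ s then σ.symm (fun j => F j) ⟨i, h⟩ else F i
      left_inv := fun F => by ext1 i; by_cases h : i ∈ s <;> simp [h]
      right_inv := fun F => by ext1 i; by_cases h : i ∈ s <;> simp [h] }
  map_one' := by ext1 F; ext1 i; by_cases h : i ∈ s <;> simp
  map_mul' σ τ := by ext1 F; ext1 i; by_cases h : i ∈ s <;> simp [h]

theorem permOn_apply_mem {ι L : Type*} {s : Set ι} (σ : Equiv.Perm (s → L)) (F : ι → L)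
    {i : ι} (h : i ∈ s) : permOn s σ F i = σ (fun j => F j) ⟨i, h⟩ :=
  dif_pos h

theorem permOn_apply_notMem {ι L : Type*} {s : Set ι} (σ : Equiv.Perm (s → L)) (F : ι → L)
    {i : ι} (h : i ∉ s) : permOn s σ F i = F i :=
  dif_neg h

theorem commute_permOn {ι L : Type*} {s t : Set ι} (hst : Disjoint s t)
    (σ : Equiv.Perm (s → L)) (τ : Equiv.Perm (t → L)) :
    Commute (permOn s σ) (permOn t τ) := by
  have hs : ∀ F : ι → L, (fun j : s => permOn t τ F j) = fun j : s => F j := fun F =>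
    funext fun j => permOn_apply_notMem _ _ (Set.disjoint_left.1 hst j.2)
  have ht : ∀ F : ι → L, (fun j : t => permOn s σ F j) = fun j : t => F j := fun F =>
    funext fun j => permOn_apply_notMem _ _ (Set.disjoint_right.1 hst j.2)
  ext1 F
  ext1 i
  simp only [Equiv.Perm.mul_apply]
  by_cases h : i ∈ s
  · have h' := Set.disjoint_left.1 hst h
    rw [permOn_apply_mem _ _ h, hs, permOn_apply_notMem _ _ h', permOn_apply_mem _ _ h]
  · rw [permOn_apply_notMem _ _ h]
    by_cases h' : i ∈ t
    · rw [permOn_apply_mem _ _ h', permOn_apply_mem _ _ h', ht]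
    · rw [permOn_apply_notMem _ _ h', permOn_apply_notMem _ _ h', permOn_apply_notMem _ _ h]

variable {V : Type v} {Γ : SimpleGraph V} {G : V → Type u} [∀ v, Group (G v)]

/-- The unordered pairs of non-adjacent vertices that contain `v`. -/
def star (Γ : SimpleGraph V) (v : V) : Set (Sym2 V) := {p | v ∈ p ∧ p ∉ Γ.edgeSet}

theorem diag_mem_star (v : V) : s(v, v) ∈ star Γ v := by simp [star]

theorem disjoint_star {u v : V} (h : Γ.Adj u v) : Disjoint (star Γ u) (star Γ v) := by
  refine Set.disjoint_left.2 fun p hu hv => hu.2 ?_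
  rw [(Sym2.mem_and_mem_iff h.ne).1 ⟨hu.1, hv.1⟩]
  exact h

open Classical in
/-- The projections of a word to the pairs of non-adjacent vertices. -/
noncomputable def trace (Γ : SimpleGraph V) : List (Σ v, G v) → Sym2 V → List (Σ v, G v)
  | [], _ => []
  | l :: w, p => if p ∈ star Γ l.1 then l :: trace Γ w p else trace Γ w p

theorem canLead_of_trace_eq {G : V → Type u} {v : V} (w : List (Σ v, G v)) (a : G v)
    (F : star Γ v → List (Σ v, G v)) (h : ∀ p : star Γ v, trace Γ w p = ⟨v, a⟩ :: F p) :
    CanLead Γ v (w.map Sigma.fst) := by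
  induction w with
  | nil => simpa [trace] using h ⟨_, diag_mem_star v⟩
  | cons l w ih =>
    by_cases hl : l.1 = v
    · exact ⟨[], w.map Sigma.fst, by simp [hl], by simp⟩
    by_cases hadj : Γ.Adj l.1 v
    · obtain ⟨x, y, hxy, hx⟩ := ih fun p => by
        rw [← h p, trace, if_neg fun hp => Set.disjoint_left.1 (disjoint_star hadj) hp p.2]
      refine ⟨l.1 :: x, y, by simp [hxy], ?_⟩
      rintro u (_ | ⟨_, hu⟩)
      exacts [hadj, hx u hu]
    · have hp : s(l.1, v) ∈ star Γ l.1 := ⟨by simp, hadj⟩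
      have hq : s(l.1, v) ∈ star Γ v := ⟨by simp, hadj⟩
      have := h ⟨_, hq⟩
      rw [trace, if_pos hp] at this
      injection this with h1 _
      exact absurd (congrArg Sigma.fst h1) hl

theorem exists_permHom_trace (Γ : SimpleGraph V) (G : V → Type u) [∀ v, Group (G v)] (v : V) :
    ∃ ρ : G v →* Equiv.Perm (star Γ v → List (Σ v, G v)), ∀ (a : G v) (w : List (Σ v, G v)),
      a ≠ 1 → ¬ CanLead Γ v (w.map Sigma.fst) →
        ρ a (fun p => trace Γ w p) = fun p : star Γ v => ⟨v, a⟩ :: trace Γ w p := by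
  obtain ⟨ρ, hρ⟩ := exists_permHom
    (fun (a : G v) (F : star Γ v → List (Σ v, G v)) p => ⟨v, a⟩ :: F p) <| by
      intro a b F F' h
      have h' := fun p => List.cons.inj (congrFun h p)
      exact ⟨by simpa using (h' ⟨_, diag_mem_star v⟩).1, funext fun p => (h' p).2⟩
  exact ⟨ρ, fun a w ha hw => hρ a _ ha fun b F h =>
    hw (canLead_of_trace_eq w b F fun p => congrFun h p)⟩

/-- Nonempty reduced words represent nontrivial elements of the graph product. -/
theorem IsReduced.wordProd_ne_one {w : List (Σ v, G v)} (hw : IsReduced Γ w) (hne : w ≠ []) :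
    wordProd Γ w ≠ 1 := by
  choose ρ hρ using exists_permHom_trace Γ G
  let Φ : GraphProduct Γ G →* Equiv.Perm (Sym2 V → List (Σ v, G v)) :=
    lift (fun v => (permOn (star Γ v)).comp (ρ v)) fun u v h a b =>
      commute_permOn (disjoint_star h) _ _
  have key : ∀ w : List (Σ v, G v), IsReduced Γ w → Φ (wordProd Γ w) (fun _ => []) = trace Γ w := by
    intro w
    induction w with
    | nil => intro _; ext1 p; simp [trace]
    | cons l w ih =>
      rintro ⟨h1, h2, h3⟩
      rw [wordProd_cons, map_mul, Equiv.Perm.mul_apply, ih ⟨fun l hl => h1 l (by simp [hl]), h3⟩]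
      simp only [Φ, lift_of, MonoidHom.comp_apply]
      ext1 p
      by_cases hp : p ∈ star Γ l.1
      · rw [permOn_apply_mem _ _ hp, hρ _ _ _ (h1 l (by simp)) h2, trace, if_pos hp]
      · rw [permOn_apply_notMem _ _ hp, trace, if_neg hp]
  intro h
  have := key w hw
  cases w with
  | nil => exact hne rfl
  | cons l w =>
    rw [h, map_one] at this
    have := congrFun this s(l.1, l.1)
    rw [trace, if_pos (diag_mem_star _)] at this
    simp at this

end Action

section Approximation

variable {V : Type v} {Γ : SimpleGraph V} {G : V → Type u} [∀ v, Group (G v)]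

/-- The families that are eventually trivial along a filter. -/
def eventuallyOne {I : Type*} (l : Filter I) (H : I → Type*) [∀ i, Group (H i)] :
    Subgroup (∀ i, H i) where
  carrier := {f | ∀ᶠ i in l, f i = 1}
  one_mem' := Eventually.of_forall fun _ => rfl
  mul_mem' := fun {f g} hf hg => by
    filter_upwards [hf, hg] with i h1 h2
    simp [h1, h2]
  inv_mem' := fun {f} hf => by
    filter_upwards [hf] with i h1
    simp [h1]

instance eventuallyOne_normal {I : Type*} (l : Filter I) (H : I → Type*) [∀ i, Group (H i)] :
    (eventuallyOne l H).Normal where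
  conj_mem := fun f hf g => by
    filter_upwards [show ∀ᶠ i in l, f i = 1 from hf] with i h1
    simp [h1]

theorem mk_eventuallyOne_eq_iff {I : Type*} {l : Filter I} {H : I → Type*} [∀ i, Group (H i)]
    {f g : ∀ i, H i} :
    (QuotientGroup.mk f : (∀ i, H i) ⧸ eventuallyOne l H) = QuotientGroup.mk g ↔
      ∀ᶠ i in l, f i = g i := by
  rw [QuotientGroup.eq]
  refine eventually_congr (Eventually.of_forall fun i => ?_)
  simp only [Pi.mul_apply, Pi.inv_apply]
  rw [inv_mul_eq_one]

/-- Asymptotically multiplicative and injective maps of the vertex groups induce such maps of the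
graph products. -/
theorem exists_asymptotic_map {I : Type*} (l : Filter I) (C : I → V → Type*)
    [∀ i v, Group (C i v)] (φ : ∀ i v, G v → C i v)
    (hmul : ∀ v a b, ∀ᶠ i in l, φ i v (a * b) = φ i v a * φ i v b)
    (hone : ∀ v a, a ≠ 1 → ∀ᶠ i in l, φ i v a ≠ 1) :
    ∃ f : ∀ i, GraphProduct Γ G → GraphProduct Γ (C i),
      (∀ g h, ∀ᶠ i in l, f i (g * h) = f i g * f i h) ∧ ∀ g, g ≠ 1 → ∀ᶠ i in l, f i g ≠ 1 := by
  let N := eventuallyOne l fun i => GraphProduct Γ (C i)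
  let ψ : ∀ v, G v →* (∀ i, GraphProduct Γ (C i)) ⧸ N := fun v =>
    MonoidHom.mk' (fun a => QuotientGroup.mk fun i => of Γ v (φ i v a)) fun a b => by
      rw [← QuotientGroup.mk_mul, mk_eventuallyOne_eq_iff]
      filter_upwards [hmul v a b] with i hi
      simp [hi]
  let Φ : GraphProduct Γ G →* (∀ i, GraphProduct Γ (C i)) ⧸ N :=
    lift ψ fun u v h a b =>
      congrArg QuotientGroup.mk (funext fun i => (commute_of h (φ i u a) (φ i v b)).eq)
  have hout : ∀ g, (QuotientGroup.mk (Φ g).out : (∀ i, GraphProduct Γ (C i)) ⧸ N) = Φ g :=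
    fun g => QuotientGroup.out_eq' _
  refine ⟨fun i g => (Φ g).out i, fun g h => ?_, fun g hg => ?_⟩
  · have : (QuotientGroup.mk (Φ (g * h)).out : (∀ i, GraphProduct Γ (C i)) ⧸ N) =
        QuotientGroup.mk ((Φ g).out * (Φ h).out) := by
      rw [QuotientGroup.mk_mul, hout, hout, hout, map_mul]
    exact mk_eventuallyOne_eq_iff.1 this
  · obtain ⟨w, hw, rfl⟩ := exists_isReduced g
    have hne : w ≠ [] := fun h => hg (by simp [h])
    have hword : ∀ w : List (Σ v, G v), Φ (wordProd Γ w) =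
        QuotientGroup.mk fun i => wordProd Γ (w.map fun l => (⟨l.1, φ i l.1 l.2⟩ : Σ v, C i v)) := by
      intro w
      induction w with
      | nil => exact map_one Φ
      | cons l w ih =>
        rw [wordProd_cons, map_mul, ih]
        simp only [List.map_cons, wordProd_cons]
        rw [show Φ (of Γ l.1 l.2) = ψ l.1 l.2 from lift_of _ _ _ _]
        rfl
    have hout' := mk_eventuallyOne_eq_iff.1 ((hout (wordProd Γ w)).trans (hword w))
    have hletters : ∀ᶠ i in l, ∀ x ∈ w, φ i x.1 x.2 ≠ 1 :=
      (eventually_all_finite w.finite_toSet).2 fun x hx => hone x.1 x.2 (hw.1 x hx)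
    filter_upwards [hout', hletters] with i h1 h2
    rw [h1]
    refine IsReduced.wordProd_ne_one ⟨?_, ?_⟩ (by simpa using hne)
    · intro x hx
      obtain ⟨y, hy, rfl⟩ := List.mem_map.1 hx
      exact h2 y hy
    · simpa [Function.comp_def] using hw.2

end Approximation

end GraphProduct

namespace GroupClass

/-- Finitely many nontrivial elements of a residually `𝒞` group are detected by a single
homomorphism to a group in `𝒞`, if `𝒞` is closed under finite products. -/
theorem exists_hom_ne_one {𝒞 : GroupClass.{u}} (hprod : 𝒞.ClosedUnderFiniteProducts)
    {G : Type u} [Group G] (hG : 𝒞.residually.Mem G) {K : Set G} (hK : K.Finite)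
    (h1 : ∀ g ∈ K, g ≠ 1) :
    ∃ (P : Type u) (_ : Group P) (f : G →* P), 𝒞.Mem P ∧ ∀ g ∈ K, f g ≠ 1 := by
  obtain ⟨n, ⟨e⟩⟩ := hK.to_subtype.exists_equiv_fin
  choose C iC φ hC _ hφ using fun j : Fin n => hG (e.symm j) (h1 _ (e.symm j).2)
  refine ⟨∀ j, C j, inferInstance, MonoidHom.pi φ, hprod (Fin n) C hC, fun g hg h => ?_⟩
  refine hφ (e ⟨g, hg⟩) ?_
  have := congrFun h (e ⟨g, hg⟩)
  rw [e.symm_apply_apply]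
  exact this

theorem residually_of_mem {𝒞 : GroupClass.{u}} {G : Type u} [Group G] (hG : 𝒞.Mem G) :
    𝒞.residually.Mem G :=
  fun _ hg => ⟨G, inferInstance, MonoidHom.id G, hG, Function.surjective_id, hg⟩

end GroupClass

theorem theoremB (𝒞 : GroupClass.{u})
    (hsub : 𝒞.ClosedUnderSubgroups)
    (hprod : 𝒞.ClosedUnderFiniteProducts)
    (hres : 𝒞.residually.ClosedUnderGraphProducts) :
    𝒞.locallyEmbeddable.ClosedUnderGraphProducts := by
  intro V Γ G _ hG K hK
  choose C iC φ hC hφ using fun (i : Finset (Σ v, G v)) (v : V) =>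
    hG v {a | (⟨v, a⟩ : Σ v, G v) ∈ i} (i.finite_toSet.preimage sigma_mk_injective.injOn)
  have hmem : ∀ v (a : G v), ∀ᶠ i : Finset (Σ v, G v) in atTop, (⟨v, a⟩ : Σ v, G v) ∈ i :=
    fun v a => (eventually_ge_atTop {⟨v, a⟩}).mono fun i hi => hi (Finset.mem_singleton_self _)
  have hmul : ∀ v a b, ∀ᶠ i in atTop, φ i v (a * b) = φ i v a * φ i v b := fun v a b => by
    filter_upwards [hmem v a, hmem v b] with i ha hb
    exact (hφ i v).1 a ha b hb
  obtain ⟨f, hf, hf1⟩ := GraphProduct.exists_asymptotic_map (Γ := Γ) atTop C φ hmul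
    fun v a ha => by
      filter_upwards [hmem v a, hmem v 1, hmul v 1 1] with i hi h1 h11 h
      rw [one_mul, left_eq_mul] at h11
      exact ha ((hφ i v).2 hi h1 (h.trans h11.symm))
  have hmulK : ∀ᶠ i in atTop, ∀ k ∈ K, ∀ k' ∈ K, f i (k * k') = f i k * f i k' := by
    simp only [eventually_all_finite hK]
    exact fun k _ k' _ => hf k k'
  have hinjK : ∀ᶠ i in atTop, ∀ k ∈ K, ∀ k' ∈ K, k ≠ k' → f i k ≠ f i k' := by
    simp only [eventually_all_finite hK]
    intro k _ k' _
    by_cases hkk : k = k'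
    · exact Eventually.of_forall fun i h => absurd hkk h
    filter_upwards [hf (k * k'⁻¹) k', hf1 (k * k'⁻¹) (by rwa [Ne, mul_inv_eq_one])] with i h1 h2 _ h3
    rw [inv_mul_cancel_right, h3, right_eq_mul] at h1
    exact h2 h1
  obtain ⟨i, hi, hi'⟩ := (hmulK.and hinjK).exists
  have hGP := hres V Γ (C i) fun v => GroupClass.residually_of_mem (hC i v)
  obtain ⟨P, iP, ψ, hP, hψ⟩ := GroupClass.exists_hom_ne_one hprod hGP
    (K := ((fun p : GraphProduct Γ G × GraphProduct Γ G => f i p.1 / f i p.2) '' (K ×ˢ K)) \ {1})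
    (((hK.prod hK).image _).sdiff) fun g hg => hg.2
  refine ⟨P, iP, ψ ∘ f i, hP, fun k hk k' hk' => ?_, fun k hk k' hk' h => ?_⟩
  · simp [hi k hk k' hk']
  · by_contra hne
    refine hψ (f i k / f i k') ⟨⟨(k, k'), ⟨hk, hk'⟩, rfl⟩, ?_⟩ ?_
    · simpa [div_eq_one] using hi' k hk k' hk' hne
    · rw [map_div, div_eq_one]
      exact h
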